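/- Setting. Let $L$ be a countable first-order language and let $L^*=L\cup\{R_i : i\in I\}$, where $I$ is countable and each $R_i\notin L$ is a relation symbol, of arity $a(i)$. A Fraïssé structure is a countably infinite, locally finite (finitely generated substructures are finite), ultrahomogeneous (every embedding of a finitely generated substructure into the structure extends to an automorphism) structure. The age of such a structure is the class of all finite structures that embed into it. Let $\mathbf F$ be a Fraïssé structure in $L$ and let $\mathbf F^*=(\mathbf F,\vec R^*)$, with $\vec R^*=(R_i^*)_{i\in I}$, be an expansion of $\mathbf F$ to $L^*$ which is also a Fraïssé structure. Suppose that $\mathbf F^*$ is a precompact expansion of $\mathbf F$, i.e. every $\mathbf A\in\mathrm{Age}(\mathbf F)$ has only finitely many expansions in $\mathrm{Age}(\mathbf F^*)$, and that every element of $\mathrm{Age}(\mathbf F^*)$ is rigid (has no non-trivial automorphism). Let $G=\mathrm{Aut}(\mathbf F)$ with the topology of pointwise convergence ($\mathbf F$ being discrete). Let $P^*=\prod_{i\in I}\{0,1\}^{\mathbf F^{a(i)}}$ be the set of all interpretations on $\mathbf F$ of the symbols $R_i$. Identifying the universe of $\mathbf F$ with $\mathbb N$, equip $P^*$ with the topology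 of the metric $\sup_i d_i$, where $d_i(S_i,T_i)=2^{-m}$ with $m$ the least $n$ such that $S_i$ and $T_i$ differ on $\{0,\dots,n-1\}^{a(i)}$ (and $d_i(S_i,T_i)=0$ if $S_i=T_i$); this topology does not depend on the identification. Let $G$ act on $P^*$ by $(g\cdot S_i)(y_1,\dots,y_{a(i)})\Leftrightarrow S_i(g^{-1}y_1,\dots,g^{-1}y_{a(i)})$, and let $X^*=\overline{G\cdot\vec R^*}\subset P^*$. A $G$-flow is a continuous action of $G$ on a topological space. A compact flow (on a nonempty compact Hausdorff space) is minimal if every orbit is dense. It is the universal minimal flow of $G$ if it is minimal and every compact minimal $G$-flow $G\curvearrowright Y$ is a factor of it, i.e. the image of it under a continuous $G$-equivariant surjection. For structures $\mathbf A,\mathbf B$ let $\binom{\mathbf B}{\mathbf A}$ be the set of substructures of $\mathbf B$ isomorphic to $\mathbf A$. A class $\mathcal K$ of finite structures has the Ramsey property if for all $k\in\mathbb N$ and $\mathbf A,\mathbf B\in\mathcal K$ there is $\mathbf C\in\mathcal K$ such that for every $c:\binom{\mathbf C}{\mathbf A}\to\{0,\dots,k-1\}$ there is $\widetilde{\mathbf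 B}\in\binom{\mathbf C}{\mathbf B}$ such that $c$ takes at most one value on $\binom{\widetilde{\mathbf B}}{\mathbf A}$. The class $\mathrm{Age}(\mathbf F^*)$ has the expansion property relative to $\mathrm{Age}(\mathbf F)$ if for every $\mathbf A\in\mathrm{Age}(\mathbf F)$ there is $\mathbf B\in\mathrm{Age}(\mathbf F)$ such that every expansion of $\mathbf A$ in $\mathrm{Age}(\mathbf F^*)$ embeds into every expansion of $\mathbf B$ in $\mathrm{Age}(\mathbf F^*)$. Theorem. The following are equivalent: i) The flow $G\curvearrowright X^*$ is the universal minimal flow of $G$. ii) The class $\mathrm{Age}(\mathbf F^*)$ has the Ramsey property as well as the expansion property relative to $\mathrm{Age}(\mathbf F)$. -/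

import Mathlib

universe u v u₂ v₂ w

open scoped FirstOrder

namespace KPT

open CategoryTheory (Bundled)

/-! ### Fraïssé structures, automorphism groups -/

/-- A Fraïssé structure: a countably infinite, locally finite, ultrahomogeneous structure. -/
structure IsFraisseStructure (L : FirstOrder.Language.{u, v}) (M : Type) [L.Structure M] : Prop where
  countable : Countable M
  infinite : Infinite M
  locallyFinite : ∀ S : L.Substructure M, S.FG → Finite S
  ultrahomogeneous : L.IsUltrahomogeneous M

/-- A class of structures consists of rigid structures if every automorphism of every member
is the identity. -/
def ConsistsOfRigid {L : FirstOrder.Language.{u, v}} (K : Set (Bundled.{0} L.Structure)) : Prop :=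
  ∀ A ∈ K, ∀ f : A ≃[L] A, f = FirstOrder.Language.Equiv.refl L A

section Aut

variable {L : FirstOrder.Language.{u, v}} {M : Type} [L.Structure M]

/-- The automorphism group of a structure, with composition as multiplication. -/
instance autGroup : Group (M ≃[L] M) where
  mul f g := f.comp g
  one := FirstOrder.Language.Equiv.refl L M
  inv f := f.symm
  mul_assoc _ _ _ := rfl
  one_mul _ := rfl
  mul_one _ := rfl
  inv_mul_cancel f := by
    ext x
    exact f.toEquiv.symm_apply_apply x

theorem aut_mul_apply (f g : M ≃[L] M) (x : M) : (f * g) x = f (g x) := rfl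

theorem aut_inv_apply_self (f : M ≃[L] M) (x : M) : f⁻¹ (f x) = x :=
  f.toEquiv.symm_apply_apply x

theorem aut_apply_inv_self (f : M ≃[L] M) (x : M) : f (f⁻¹ x) = x :=
  f.toEquiv.apply_symm_apply x

/-- The topology of pointwise convergence on the automorphism group: the sets
`{h | h = g on F}`, for `F` finite, form a neighbourhood basis at `g`. -/
instance autTopology : TopologicalSpace (M ≃[L] M) where
  IsOpen U := ∀ g ∈ U, ∃ F : Finset M, ∀ h : M ≃[L] M, (∀ x ∈ F, h x = g x) → h ∈ U
  isOpen_univ _ _ := ⟨∅, fun _ _ => trivial⟩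
  isOpen_inter U V hU hV g hg := by
    classical
    obtain ⟨F, hF⟩ := hU g hg.1
    obtain ⟨F', hF'⟩ := hV g hg.2
    exact ⟨F ∪ F', fun h hh =>
      ⟨hF h fun x hx => hh x (Finset.mem_union_left _ hx),
        hF' h fun x hx => hh x (Finset.mem_union_right _ hx)⟩⟩
  isOpen_sUnion 𝒰 h𝒰 g hg := by
    obtain ⟨U, hU, hgU⟩ := hg
    obtain ⟨F, hF⟩ := h𝒰 U hU g hgU
    exact ⟨F, fun h hh => ⟨U, hU, hF h hh⟩⟩

theorem aut_mem_nhds {g : M ≃[L] M} {U : Set (M ≃[L] M)} :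
    U ∈ nhds g ↔ ∃ F : Finset M, ∀ h : M ≃[L] M, (∀ x ∈ F, h x = g x) → h ∈ U := by
  rw [mem_nhds_iff]
  constructor
  · rintro ⟨V, hVU, hV, hg⟩
    obtain ⟨F, hF⟩ := hV g hg
    exact ⟨F, fun h hh => hVU (hF h hh)⟩
  · rintro ⟨F, hF⟩
    refine ⟨{h | ∀ x ∈ F, h x = g x}, hF, ?_, fun _ _ => rfl⟩
    intro h hh
    exact ⟨F, fun k hk x hx => (hk x hx).trans (hh x hx)⟩

instance autIsTopologicalGroup : IsTopologicalGroup (M ≃[L] M) where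
  continuous_mul := by
    classical
    rw [continuous_iff_continuousAt]
    rintro ⟨g, h⟩ U hU
    obtain ⟨F, hF⟩ := aut_mem_nhds.1 hU
    have h1 : {h' : M ≃[L] M | ∀ x ∈ F, h' x = h x} ∈ nhds h :=
      aut_mem_nhds.2 ⟨F, fun _ hk => hk⟩
    have h2 : {g' : M ≃[L] M | ∀ x ∈ F.image h, g' x = g x} ∈ nhds g :=
      aut_mem_nhds.2 ⟨F.image h, fun _ hk => hk⟩
    refine Filter.mem_map.2 (Filter.mem_of_superset (prod_mem_nhds h2 h1) ?_)
    rintro ⟨g', h'⟩ ⟨hg', hh'⟩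
    refine hF _ fun x hx => ?_
    change g' (h' x) = g (h x)
    rw [hh' x hx]
    exact hg' _ (Finset.mem_image_of_mem _ hx)
  continuous_inv := by
    classical
    rw [continuous_iff_continuousAt]
    intro g U hU
    obtain ⟨F, hF⟩ := aut_mem_nhds.1 hU
    refine Filter.mem_map.2 (aut_mem_nhds.2 ⟨F.image (g⁻¹ : M ≃[L] M), fun h hh => hF _ ?_⟩)
    intro x hx
    have := hh _ (Finset.mem_image_of_mem _ hx)
    rw [aut_apply_inv_self] at this
    rw [← aut_inv_apply_self h ((g⁻¹ : M ≃[L] M) x), this]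

end Aut

/-! ### Flows -/

/-- A flow `G ↷ X` is universal if every compact (Hausdorff, nonempty) minimal flow of `G`
is a factor of it. -/
def IsUniversalFlow (G : Type u) [Group G] [TopologicalSpace G]
    (X : Type v) [TopologicalSpace X] [MulAction G X] : Prop :=
  ∀ (Y : Type w) [TopologicalSpace Y] [CompactSpace Y] [T2Space Y] [Nonempty Y]
    [MulAction G Y] [ContinuousSMul G Y] [MulAction.IsMinimal G Y],
    ∃ π : X → Y, Continuous π ∧ Function.Surjective π ∧ ∀ (g : G) (x : X), π (g • x) = g • π x

/-- `G ↷ X` is the universal minimal flow of `G`: a compact flow which is both minimal and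
universal. -/
structure IsUniversalMinimalFlow (G : Type u) [Group G] [TopologicalSpace G]
    (X : Type v) [TopologicalSpace X] [MulAction G X] : Prop where
  continuousSMul : ContinuousSMul G X
  compactSpace : CompactSpace X
  t2Space : T2Space X
  nonempty : Nonempty X
  minimal : MulAction.IsMinimal G X
  universal : IsUniversalFlow.{u, v, w} G X

/-! ### The space of relational expansions and the flow `X*`

A relational expansion of an `L`-structure `M` is an `L.sum R`-structure `(M, R*)`, where `R` is a
relational language and `R*` an `R`-structure on `M`. -/

/-- The space `P*` of all interpretations on `M` of the relation symbols of `R`. -/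
def ExpansionSpace (R : FirstOrder.Language.{u₂, v₂}) (M : Type) : Type v₂ :=
  ∀ i : (Σ n, R.Relations n), (Fin i.1 → M) → Prop

section ExpansionSpace

variable {R : FirstOrder.Language.{u₂, v₂}} {M : Type}

/-- All relations of `S` and `T` coincide on the finite set `F`. -/
def AgreeOn (F : Finset M) (S T : ExpansionSpace R M) : Prop :=
  ∀ (i : Σ n, R.Relations n) (y : Fin i.1 → M), (∀ j, y j ∈ F) → (S i y ↔ T i y)

/-- The topology of the supremum `d(S, T) = sup_i d_i(S_i, T_i)` of the ultrametrics
`d_i(S_i, T_i) = 2 ^ (-min {n | S_i and T_i differ on {x_0, …, x_{n-1}}})`, where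
`x_0, x_1, …` is any enumeration of the countable set `M`: the sets `{T | AgreeOn F S T}`, for `F`
finite, form a neighbourhood basis at `S`. Here one `F` serves for all symbols simultaneously,
so that this is finer than the product topology when there are infinitely many symbols. -/
instance expansionTopology : TopologicalSpace (ExpansionSpace R M) where
  IsOpen U := ∀ S ∈ U, ∃ F : Finset M, ∀ T, AgreeOn F S T → T ∈ U
  isOpen_univ _ _ := ⟨∅, fun _ _ => trivial⟩
  isOpen_inter U V hU hV S hS := by
    classical
    obtain ⟨F, hF⟩ := hU S hS.1
    obtain ⟨F', hF'⟩ := hV S hS.2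
    exact ⟨F ∪ F', fun T hT =>
      ⟨hF T fun i y hy => hT i y fun j => Finset.mem_union_left _ (hy j),
        hF' T fun i y hy => hT i y fun j => Finset.mem_union_right _ (hy j)⟩⟩
  isOpen_sUnion 𝒰 h𝒰 S hS := by
    obtain ⟨U, hU, hSU⟩ := hS
    obtain ⟨F, hF⟩ := h𝒰 U hU S hSU
    exact ⟨F, fun T hT => ⟨U, hU, hF T hT⟩⟩

theorem expansion_mem_nhds {S : ExpansionSpace R M} {U : Set (ExpansionSpace R M)} :
    U ∈ nhds S ↔ ∃ F : Finset M, ∀ T, AgreeOn F S T → T ∈ U := by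
  rw [mem_nhds_iff]
  constructor
  · rintro ⟨V, hVU, hV, hS⟩
    obtain ⟨F, hF⟩ := hV S hS
    exact ⟨F, fun T hT => hVU (hF T hT)⟩
  · rintro ⟨F, hF⟩
    refine ⟨{T | AgreeOn F S T}, hF, ?_, fun _ _ _ => Iff.rfl⟩
    intro T hT
    exact ⟨F, fun T' hT' i y hy => (hT i y hy).trans (hT' i y hy)⟩

variable {L : FirstOrder.Language.{u, v}} [L.Structure M]

/-- The logic action of `Aut(M)`: `(g • S_i)(y_1, …) ↔ S_i(g⁻¹ y_1, …)`. -/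
instance logicAction : MulAction (M ≃[L] M) (ExpansionSpace R M) where
  smul g S := fun i y => S i fun j => (g⁻¹ : M ≃[L] M) (y j)
  one_smul _ := rfl
  mul_smul _ _ _ := rfl

theorem logicAction_apply (g : M ≃[L] M) (S : ExpansionSpace R M) (i : Σ n, R.Relations n)
    (y : Fin i.1 → M) : (g • S) i y ↔ S i fun j => (g⁻¹ : M ≃[L] M) (y j) := Iff.rfl

instance logicAction_continuousSMul : ContinuousSMul (M ≃[L] M) (ExpansionSpace R M) where
  continuous_smul := by
    classical
    rw [continuous_iff_continuousAt]
    rintro ⟨g, S⟩ U hU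
    obtain ⟨F, hF⟩ := expansion_mem_nhds.1 hU
    have h1 : {h : M ≃[L] M | ∀ x ∈ F, (h⁻¹ : M ≃[L] M) x = (g⁻¹ : M ≃[L] M) x} ∈ nhds g :=
      (continuous_inv (G := M ≃[L] M)).continuousAt.preimage_mem_nhds
        (aut_mem_nhds.2 ⟨F, fun _ hk => hk⟩)
    have h2 : {T : ExpansionSpace R M | AgreeOn (F.image (g⁻¹ : M ≃[L] M)) S T} ∈ nhds S :=
      expansion_mem_nhds.2 ⟨_, fun _ hT => hT⟩
    refine Filter.mem_map.2 (Filter.mem_of_superset (prod_mem_nhds h1 h2) ?_)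
    rintro ⟨h, T⟩ ⟨hh, hT⟩
    refine hF _ fun i y hy => ?_
    change S i (fun j => (g⁻¹ : M ≃[L] M) (y j)) ↔ T i (fun j => (h⁻¹ : M ≃[L] M) (y j))
    have e : (fun j => (h⁻¹ : M ≃[L] M) (y j)) = fun j => (g⁻¹ : M ≃[L] M) (y j) :=
      funext fun j => hh _ (hy j)
    rw [e]
    exact hT i _ fun j => Finset.mem_image_of_mem _ (hy j)

end ExpansionSpace

/-- The point of the expansion space given by an `R`-structure on `M`. -/
def expansionPoint (R : FirstOrder.Language.{u₂, v₂}) (M : Type) [R.Structure M] : ExpansionSpace R M :=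
  fun i y => FirstOrder.Language.Structure.RelMap i.2 y

/-- `X*`, the closure in the expansion space of the orbit of `R*` under `G = Aut(M)`, as a
`G`-invariant set. -/
def orbitClosure (L : FirstOrder.Language.{u, v}) (R : FirstOrder.Language.{u₂, v₂}) (M : Type) [L.Structure M]
    [R.Structure M] : SubMulAction (M ≃[L] M) (ExpansionSpace R M) where
  carrier := closure (MulAction.orbit (M ≃[L] M) (expansionPoint R M))
  smul_mem' g _ hx := by
    refine map_mem_closure (continuous_const_smul g) hx ?_
    intro y hy
    exact MulAction.mem_orbit_of_mem_orbit g hy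

/-! ### Combinatorial properties of ages -/

/-- The copies of `A` in `C`: the substructures of `C` which are isomorphic to `A`. -/
def Copies (L : FirstOrder.Language.{u, v}) (A C : Type) [L.Structure A] [L.Structure C] :
    Set (L.Substructure C) :=
  {S | Nonempty (A ≃[L] S)}

/-- The arrow relation `C → (B)^A_k`: for every `k`-colouring of the copies of `A` in `C` there is
a copy of `B` in `C` all of whose copies of `A` have the same colour. -/
def Arrow (L : FirstOrder.Language.{u, v}) (A B C : Type) [L.Structure A] [L.Structure B] [L.Structure C]
    (k : ℕ) : Prop :=
  ∀ c : Copies L A C → Fin k, ∃ B' ∈ Copies L B C,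
    ∀ A₁ A₂ : Copies L A C, A₁.1 ≤ B' → A₂.1 ≤ B' → c A₁ = c A₂

/-- The Ramsey property of a class of structures. -/
def RamseyProperty {L : FirstOrder.Language.{u, v}} (K : Set (Bundled.{0} L.Structure)) : Prop :=
  ∀ k : ℕ, ∀ A ∈ K, ∀ B ∈ K, ∃ C ∈ K, Arrow L A B C k

section Expansions

variable {L : FirstOrder.Language.{u, v}} {R : FirstOrder.Language.{u₂, v₂}}

/-- The expansion of an `L`-structure `A` by an interpretation `σ` of the symbols of `R`. -/
def expand (A : Bundled.{0} L.Structure) (σ : R.Structure A) : Bundled.{0} (L.sum R).Structure :=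
  ⟨A, FirstOrder.Language.sumStructure L R A⟩

variable (L R)

/-- `(M, R*)` is a precompact expansion of `M`: every member of the age of `M` has
only finitely many expansions in the age of `(M, R*)`. -/
def IsPrecompactExpansion (M : Type) [L.Structure M] [R.Structure M] : Prop :=
  ∀ A ∈ L.age M, {σ : R.Structure A | expand A σ ∈ (L.sum R).age M}.Finite

/-- The expansion property of the age of `(M, R*)` relative to the age of `M`. -/
def ExpansionProperty (M : Type) [L.Structure M] [R.Structure M] : Prop :=
  ∀ A ∈ L.age M, ∃ B ∈ L.age M, ∀ (σ : R.Structure A) (τ : R.Structure B),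
    expand A σ ∈ (L.sum R).age M → expand B τ ∈ (L.sum R).age M →
      Nonempty (expand A σ ↪[L.sum R] expand B τ)

end Expansions

end KPT

namespace KPT

/-! ### Compact flows -/

section Flows

open Topology

/-! Write F* for the expansion and G* ≤ G for its automorphism group. By ultrahomogeneity of F, the
points of X* induce on a finite A ⊂ F exactly the expansions of A in the age of F*. Precompactness
therefore makes X* compact, and density of all orbits in X* amounts to the expansion property
(`expansionProperty_of_isMinimal`, `isMinimal_of_expansionProperty`). Rigidity identifies copies of
A with embeddings of A, and compactness replaces the Ramsey witness C by F* itself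
(`ramseyProperty_age_iff`).

Ramsey implies universal: the Ramsey property gives G* a fixed point y in every compact G-flow Y
(`exists_fixedPoint_of_ramsey`). The map gR* ↦ gy is uniformly continuous on the orbit of R*, so it
extends to a factor map X* → Y.

Universal implies Ramsey: encode a colouring of the embeddings of A into F* as a point χ of a
compact space of relations on F, and choose a minimal subflow Z of the orbit closure of (R*, χ).
Universality gives X* → Z; followed by the projection to X* it is an endomorphism of X*, injective
by coalescence (`injective_of_universal`). Hence a preimage of R* is fixed by G*, and some (R*, χ')
in Z has χ' invariant under G*. Invariance and ultrahomogeneity of F* make χ' monochromatic. Since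
(R*, χ') is a limit of translates of (R*, χ), the original colouring is constant on some copy of any
given finite B. -/

theorem exists_minimal_subflow {G : Type u} [Group G] {Y : Type v}
    [TopologicalSpace Y] [CompactSpace Y] [MulAction G Y] (K : SubMulAction G Y)
    (hK : IsClosed (K : Set Y)) (hne : (K : Set Y).Nonempty) :
    ∃ N : SubMulAction G Y, N ≤ K ∧ IsClosed (N : Set Y) ∧ (N : Set Y).Nonempty ∧
      ∀ N' : SubMulAction G Y, N' ≤ N → IsClosed (N' : Set Y) → (N' : Set Y).Nonempty →
        N' = N := by
  let S : Set (SubMulAction G Y) :=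
    {N | N ≤ K ∧ IsClosed (N : Set Y) ∧ (N : Set Y).Nonempty}
  have lower : ∀ c : Set (SubMulAction G Y), c ⊆ S → IsChain (· ≤ ·) c → ∀ y ∈ c,
      ∃ lb ∈ S, ∀ z ∈ c, lb ≤ z := by
    intro c hcS hc y hy
    refine ⟨sInf c, ⟨?_, ?_, ?_⟩, fun z hz => sInf_le hz⟩
    · exact (sInf_le hy).trans (hcS hy).1
    · change IsClosed (⋂ z ∈ c, (z : Set Y))
      exact isClosed_biInter fun z hz => (hcS hz).2.1
    · change (⋂ z ∈ c, (z : Set Y)).Nonempty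
      have : Nonempty c := ⟨⟨y, hy⟩⟩
      have := IsCompact.nonempty_iInter_of_directed_nonempty_isCompact_isClosed
        (fun z : c => ((z : SubMulAction G Y) : Set Y)) ?_ (fun z => (hcS z.2).2.2)
        (fun z => (hcS z.2).2.1.isCompact) (fun z => (hcS z.2).2.1)
      · rwa [Set.iInter_subtype] at this
      · rintro ⟨a, ha⟩ ⟨b, hb⟩
        rcases hc.total ha hb with h | h
        · exact ⟨⟨a, ha⟩, subset_rfl, h⟩
        · exact ⟨⟨b, hb⟩, h, subset_rfl⟩
  have key : ∃ m, m ≤ K ∧ Minimal (· ∈ S) m :=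
    zorn_le_nonempty₀ (α := (SubMulAction G Y)ᵒᵈ) S
      (fun c hcS hc y hy => lower c hcS hc.symm y hy) K ⟨le_rfl, hK, hne⟩
  obtain ⟨N, hNK, hN⟩ := key
  refine ⟨N, hNK, hN.1.2.1, hN.1.2.2, fun N' h1 h2 h3 => ?_⟩
  exact le_antisymm h1 (hN.2 ⟨h1.trans hNK, h2, h3⟩ h1)

/-- The closure of an orbit, as an invariant set. -/
def closureOrbit (G : Type u) [Group G] {Y : Type v} [TopologicalSpace Y] [MulAction G Y]
    [ContinuousConstSMul G Y] (y : Y) : SubMulAction G Y where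
  carrier := closure (MulAction.orbit G y)
  smul_mem' g _ hx := map_mem_closure (continuous_const_smul g) hx fun _ hz =>
    MulAction.mem_orbit_of_mem_orbit g hz

instance subflow_continuousSMul {G : Type u} [Group G] [TopologicalSpace G] {Y : Type v}
    [TopologicalSpace Y] [MulAction G Y] [ContinuousSMul G Y] (N : SubMulAction G Y) :
    ContinuousSMul G N where
  continuous_smul := by
    refine Continuous.subtype_mk (f := fun p : G × N => p.1 • (p.2 : Y)) ?_ _
    fun_prop

theorem isMinimal_subflow {G : Type u} [Group G] {Y : Type v} [TopologicalSpace Y]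
    [MulAction G Y] [ContinuousConstSMul G Y] (N : SubMulAction G Y)
    (hN : IsClosed (N : Set Y))
    (hmin : ∀ N' : SubMulAction G Y, N' ≤ N → IsClosed (N' : Set Y) → (N' : Set Y).Nonempty →
      N' = N) : MulAction.IsMinimal G N where
  dense_orbit y := by
    have h1 : closureOrbit G (y : Y) ≤ N := by
      refine closure_minimal ?_ hN
      rintro _ ⟨g, rfl⟩
      exact N.smul_mem g y.2
    have h2 := hmin _ h1 isClosed_closure ⟨y, subset_closure (MulAction.mem_orbit_self _)⟩
    intro z
    rw [closure_subtype]
    have hz : (z : Y) ∈ closureOrbit G (y : Y) := h2.symm ▸ z.2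
    refine closure_mono ?_ hz
    rintro _ ⟨g, rfl⟩
    exact ⟨g • y, ⟨g, rfl⟩, rfl⟩

/-- Universality passes to all minimal compact flows on a space of small cardinality. -/
theorem IsUniversalFlow.exists_factor {G : Type u} [Group G] [TopologicalSpace G]
    {X : Type v} [TopologicalSpace X] [MulAction G X] (h : IsUniversalFlow.{u, v, w} G X)
    (Y : Type u₂) [Small.{w} Y] [TopologicalSpace Y] [CompactSpace Y] [T2Space Y] [Nonempty Y]
    [MulAction G Y] [ContinuousSMul G Y] [MulAction.IsMinimal G Y] :
    ∃ π : X → Y, Continuous π ∧ ∀ (g : G) (x : X), π (g • x) = g • π x := by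
  -- Universality only quantifies over spaces in the universe `w`, so the flow is transported to a
  -- model of `Y` there.
  let e := (equivShrink.{w} Y).symm
  let : MulAction G (Shrink.{w} Y) := e.mulAction G
  have hsmul : ∀ (g : G) (y : Shrink.{w} Y), e (g • y) = g • e y := fun g y =>
    e.apply_symm_apply _
  let E : Shrink.{w} Y ≃ₜ Y := (Shrink.homeomorph Y).symm
  have hE : ∀ y, E y = e y := fun _ => rfl
  have : CompactSpace (Shrink.{w} Y) := E.symm.compactSpace
  have : T2Space (Shrink.{w} Y) := E.symm.t2Space
  have : Nonempty (Shrink.{w} Y) := e.nonempty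
  have : ContinuousSMul G (Shrink.{w} Y) := ⟨by
    rw [← E.comp_continuous_iff]
    have : (E ∘ fun p : G × Shrink.{w} Y => p.1 • p.2) = fun p => p.1 • E p.2 :=
      funext fun p => hsmul _ _
    rw [this]
    fun_prop⟩
  have : MulAction.IsMinimal G (Shrink.{w} Y) := ⟨fun y => by
    have h1 := (MulAction.dense_orbit G (E y)).preimage E.isOpenMap
    refine h1.mono ?_
    rintro z ⟨g, hg⟩
    exact ⟨g, E.injective ((hsmul _ _).trans hg)⟩⟩
  obtain ⟨π, hπ, -, hg⟩ := h (Shrink.{w} Y)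
  refine ⟨E ∘ π, E.continuous.comp hπ, fun g x => ?_⟩
  simp only [Function.comp_apply, hg]
  exact hsmul _ _

theorem surjective_of_isMinimal {G : Type u} [Group G] {X : Type v} {Y : Type w}
    [TopologicalSpace X] [CompactSpace X] [Nonempty X] [MulAction G X]
    [TopologicalSpace Y] [T2Space Y] [MulAction G Y] [MulAction.IsMinimal G Y]
    {φ : X → Y} (hφ : Continuous φ) (h : ∀ (g : G) (x : X), φ (g • x) = g • φ x) :
    Function.Surjective φ := by
  obtain ⟨x⟩ := ‹Nonempty X›
  have h1 : Dense (Set.range φ) := (MulAction.dense_orbit G (φ x)).mono <| by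
    rintro _ ⟨g, rfl⟩
    exact ⟨g • x, h g x⟩
  exact Set.range_eq_univ.1 <| (isCompact_range hφ).isClosed.closure_eq ▸ h1.closure_eq

/-- Coalescence: every endomorphism of a universal minimal flow is injective. -/
theorem injective_of_universal {G : Type u} [Group G] [TopologicalSpace G]
    {X : Type v} [Small.{w} X] [TopologicalSpace X] [CompactSpace X] [T2Space X] [Nonempty X]
    [MulAction G X] [ContinuousSMul G X] [MulAction.IsMinimal G X]
    (huniv : IsUniversalFlow.{u, v, w} G X) {φ : X → X} (hφ : Continuous φ)
    (heq : ∀ (g : G) (x : X), φ (g • x) = g • φ x) : Function.Injective φ := by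
  obtain ⟨x₀⟩ := ‹Nonempty X›
  -- The Ellis semigroup of the flow; its minimal subflow `I` will turn out to be a minimal left
  -- ideal.
  let E : SubMulAction G (X → X) := closureOrbit G (id : X → X)
  obtain ⟨I, hIE, hIc, ⟨p₀, hp₀⟩, hImin⟩ := exists_minimal_subflow E isClosed_closure
    ⟨id, subset_closure (MulAction.mem_orbit_self _)⟩
  -- closed conditions on the enveloping semigroup only have to be checked on `G`
  have hE : ∀ C : Set (X → X), IsClosed C → (∀ g : G, (fun x => g • x) ∈ C) → ∀ p ∈ I, p ∈ C := by
    intro C hC hg p hp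
    refine closure_minimal ?_ hC (hIE hp)
    rintro _ ⟨g, rfl⟩
    exact hg g
  have hcomp : ∀ q : X → X, Continuous fun p : X → X => p ∘ q := fun q =>
    continuous_pi fun x => continuous_apply (q x)
  have hmul : ∀ p ∈ I, ∀ q ∈ I, p ∘ q ∈ I := fun p hp q hq =>
    hE {p | p ∘ q ∈ I} (hIc.preimage (hcomp q)) (fun g => I.smul_mem g hq) p hp
  have hideal : ∀ q ∈ I, ∀ r ∈ I, ∃ p ∈ I, p ∘ q = r := by
    intro q hq r hr
    let N : SubMulAction G (X → X) :=
      { carrier := (fun p : X → X => p ∘ q) '' I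
        smul_mem' := by
          rintro g _ ⟨p, hp, rfl⟩
          exact ⟨g • p, I.smul_mem g hp, rfl⟩ }
    have hN : N = I := hImin N (by rintro _ ⟨p, hp, rfl⟩; exact hmul p hp q hq)
      (hIc.isCompact.image (hcomp q)).isClosed ⟨_, p₀, hp₀, rfl⟩
    have hr' : r ∈ N := hN ▸ hr
    exact hr'
  have hpoint : ∀ x : X, ∃ p ∈ I, p x₀ = x := by
    intro x
    have h1 : Dense ((fun p : X → X => p x₀) '' I) :=
      (MulAction.dense_orbit G (p₀ x₀)).mono <| by
        rintro _ ⟨g, rfl⟩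
        exact ⟨g • p₀, I.smul_mem g hp₀, rfl⟩
    have h2 := (hIc.isCompact.image (continuous_apply x₀)).isClosed.closure_eq ▸ h1.closure_eq
    exact h2.ge (Set.mem_univ x)
  -- Ellis–Numakura lemma. As I ∘ e = I, the idempotent is a right identity on `I`.
  obtain ⟨e, he, hee⟩ : ∃ e ∈ (I : Set (X → X)), e ∘ e = e := by
    let : Semigroup (X → X) := { mul := fun p q => p ∘ q, mul_assoc := fun _ _ _ => rfl }
    exact exists_idempotent_in_compact_subsemigroup hcomp I ⟨p₀, hp₀⟩ hIc.isCompact hmul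
  have hright : ∀ p ∈ I, p ∘ e = p := by
    intro p hp
    obtain ⟨q, -, rfl⟩ := hideal e he p hp
    rw [Function.comp_assoc, hee]
  have : CompactSpace I := isCompact_iff_compactSpace.1 hIc.isCompact
  have : Nonempty I := ⟨⟨p₀, hp₀⟩⟩
  have : MulAction.IsMinimal G I := isMinimal_subflow I hIc hImin
  obtain ⟨α, hα, hαg⟩ := huniv.exists_factor I
  let r : X → X := α (φ x₀)
  have hr : r ∈ I := (α (φ x₀)).2
  -- An equivariant continuous map out of the Ellis semigroup is determined by its value at the
  -- identity: here it is right multiplication by `r`. It factors through `φ`, so `φ` is injective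
  -- once right multiplication by `r` is injective on `I`.
  have hψ : ∀ p ∈ I, (α (φ (p x₀)) : X → X) = p ∘ r := by
    refine hE {p | (α (φ (p x₀)) : X → X) = p ∘ r} ?_ fun g => ?_
    · exact isClosed_eq (by fun_prop) (hcomp r)
    · change (α (φ (g • x₀)) : X → X) = g • r
      rw [heq, hαg]
      rfl
  -- From s ∘ r = e and t ∘ s = e one gets t = e ∘ r, so right multiplication by `s` undoes that by
  -- `r` on `I`.
  obtain ⟨s, hs, hsr⟩ := hideal r hr e he
  obtain ⟨t, ht, hts⟩ := hideal s hs e he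
  have hter : e ∘ r = t := by rw [← hts, Function.comp_assoc, hsr, hright t ht]
  have hcancel : ∀ p ∈ I, (p ∘ r) ∘ s = p := by
    intro p hp
    calc (p ∘ r) ∘ s = ((p ∘ e) ∘ r) ∘ s := by rw [hright p hp]
      _ = p ∘ (t ∘ s) := by rw [← hter]; rfl
      _ = p := by rw [hts, hright p hp]
  intro x y hxy
  obtain ⟨p, hp, rfl⟩ := hpoint x
  obtain ⟨q, hq, rfl⟩ := hpoint y
  have h1 : p ∘ r = q ∘ r := by rw [← hψ p hp, ← hψ q hq, hxy]
  rw [← hcancel p hp, h1, hcancel q hq]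

end Flows

/-! ### Structures in the sum of two languages -/

section Structures

open CategoryTheory (Bundled)
open FirstOrder Language Structure

variable {L : FirstOrder.Language.{u, v}} {R : FirstOrder.Language.{u₂, v₂}}

theorem exists_equiv_of_embeddings {M : Type} [L.Structure M] (h : L.IsUltrahomogeneous M)
    {A : Type} [L.Structure A] (hA : FG L A) (f g : A ↪[L] M) :
    ∃ t : M ≃[L] M, ∀ x, t (g x) = f x := by
  obtain ⟨t, ht⟩ := h g.toHom.range (hA.range g.toHom)
    (f.comp g.equivRange.symm.toEmbedding)
  refine ⟨t, fun x => ?_⟩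
  have h1 := DFunLike.congr_fun ht (g.equivRange x)
  simpa using h1.symm

theorem finite_of_mem_age {M : Type} [L.Structure M] (h : IsFraisseStructure L M)
    {A : Bundled.{0} L.Structure} (hA : A ∈ L.age M) : Finite A := by
  obtain ⟨hfg, ⟨e⟩⟩ := hA
  have := h.locallyFinite _ (hfg.range e.toHom)
  exact Finite.of_equiv _ e.equivRange.symm.toEquiv

section Sum

variable {A B : Type} [L.Structure A] [R.Structure A] [L.Structure B] [R.Structure B]

/-- An embedding of `L`-structures which respects the relations of a relational language `R` is an
embedding of `L.sum R`-structures. -/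
def sumEmbedding [R.IsRelational] (e : A ↪[L] B)
    (h : ∀ (n : ℕ) (r : R.Relations n) (y : Fin n → A), RelMap r (e ∘ y) ↔ RelMap r y) :
    A ↪[L.sum R] B where
  toEmbedding := e.toEmbedding
  map_fun' := by
    rintro n (f | f) y
    · exact e.map_fun' f y
    · exact isEmptyElim f
  map_rel' := by
    rintro n (r | r) y
    · exact e.map_rel' r y
    · exact h n r y

/-- The reduct of an embedding of `L.sum R`-structures. -/
def reductEmbedding (e : A ↪[L.sum R] B) : A ↪[L] B where
  toEmbedding := e.toEmbedding
  map_fun' f y := e.map_fun' (Sum.inl f : (L.sum R).Functions _) y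
  map_rel' r y := e.map_rel' (Sum.inl r : (L.sum R).Relations _) y

theorem relMap_embedding (e : A ↪[L.sum R] B) {n : ℕ} (r : R.Relations n) (y : Fin n → A) :
    RelMap r (e ∘ y) ↔ RelMap r y :=
  e.map_rel' (Sum.inr r : (L.sum R).Relations _) y

/-- The reduct of an isomorphism of `L.sum R`-structures. -/
def reductEquiv (e : A ≃[L.sum R] B) : A ≃[L] B where
  toEquiv := e.toEquiv
  map_fun' f y := e.map_fun' (Sum.inl f : (L.sum R).Functions _) y
  map_rel' r y := e.map_rel' (Sum.inl r : (L.sum R).Relations _) y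

end Sum

theorem reductEquiv_smul_expansionPoint {M : Type} [L.Structure M] [R.Structure M]
    (s : M ≃[L.sum R] M) : reductEquiv s • expansionPoint R M = expansionPoint R M := by
  funext i y
  have h := relMap_embedding s.symm.toEmbedding i.2 y
  exact propext h

/-- The structure induced by a point of the expansion space. -/
@[reducible] def pull [R.IsRelational] {A M : Type} (S : ExpansionSpace R M) (a : A → M) : R.Structure A where
  funMap f := isEmptyElim f
  RelMap r y := S ⟨_, r⟩ (a ∘ y)

theorem structure_ext_of_isRelational [R.IsRelational] {A : Type} {σ τ : R.Structure A}
    (h : ∀ (n : ℕ) (r : R.Relations n) (y : Fin n → A),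
      σ.RelMap r y ↔ τ.RelMap r y) : σ = τ := by
  refine Structure.ext ?_ ?_
  · funext n f
    exact isEmptyElim f
  · funext n r y
    exact propext (h n r y)

section Pull

variable [R.IsRelational] {A M : Type}

/-- With `agreeOn_of_pull_eq`, this translates between basic neighbourhoods in the expansion space
and induced expansions of finite structures. -/
theorem pull_eq_of_agreeOn {S T : ExpansionSpace R M} {F : Finset M} (h : AgreeOn F S T)
    {a : A → M} (ha : ∀ x, a x ∈ F) : pull S a = pull T a :=
  structure_ext_of_isRelational fun n r y => h ⟨n, r⟩ (a ∘ y) fun j => ha (y j)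

theorem agreeOn_of_pull_eq {S T : ExpansionSpace R M} {F : Finset M} {a : A → M}
    (h : pull S a = pull T a) (ha : ∀ x ∈ F, ∃ z, a z = x) : AgreeOn F S T := by
  intro i y hy
  choose z hz using fun j => ha (y j) (hy j)
  have e : y = a ∘ z := funext fun j => (hz j).symm
  have h1 : (pull S a).RelMap i.2 z ↔ (pull T a).RelMap i.2 z := by rw [h]
  rw [e]
  exact h1

theorem pull_smul [L.Structure M] (g : M ≃[L] M) (S : ExpansionSpace R M) (a : A → M) :
    pull (g • S) a = pull S ((g⁻¹ : M ≃[L] M) ∘ a) := rfl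

theorem pull_smul_comp [L.Structure M] (g : M ≃[L] M) (S : ExpansionSpace R M) (a : A → M) :
    pull (g • S) (g ∘ a) = pull S a := by
  rw [pull_smul]
  congr 1
  funext x
  exact aut_inv_apply_self g (a x)

end Pull

/-! ### Separation, closure and compactness in the expansion space -/

instance expansionSpace_t2Space {M : Type} : T2Space (ExpansionSpace R M) where
  t2 S T hST := by
    classical
    obtain ⟨F, hF⟩ : ∃ F : Finset M, ¬ AgreeOn F S T := by
      by_contra! h
      refine hST (funext fun i => funext fun y => propext ?_)
      exact h (Finset.univ.image y) i y fun j => Finset.mem_image_of_mem _ (Finset.mem_univ j)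
    have hopen : ∀ S : ExpansionSpace R M, IsOpen {T | AgreeOn F S T} := fun S T hT =>
      ⟨F, fun T' hT' i y hy => (hT i y hy).trans (hT' i y hy)⟩
    refine ⟨_, _, hopen S, hopen T, fun _ _ _ => Iff.rfl, fun _ _ _ => Iff.rfl, ?_⟩
    refine Set.disjoint_left.2 fun U h1 h2 => hF fun i y hy => (h1 i y hy).trans (h2 i y hy).symm

theorem mem_closure_expansion {M : Type} {C : Set (ExpansionSpace R M)} {S : ExpansionSpace R M} :
    S ∈ closure C ↔ ∀ F : Finset M, ∃ T ∈ C, AgreeOn F S T := by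
  rw [mem_closure_iff_nhds]
  constructor
  · intro h F
    obtain ⟨T, h1, h2⟩ := h _ (expansion_mem_nhds.2 ⟨F, fun T hT => hT⟩)
    exact ⟨T, h2, h1⟩
  · intro h U hU
    obtain ⟨F, hF⟩ := expansion_mem_nhds.1 hU
    obtain ⟨T, h1, h2⟩ := h F
    exact ⟨T, hF T h2, h1⟩

/-- Total boundedness plus completeness. An ultrafilter has a pointwise limit; since `F` must serve
all symbols at once, convergence needs the ultrafilter to concentrate on one of the finitely many
agreement classes over `F`. -/
theorem isCompact_expansion {M : Type} {C : Set (ExpansionSpace R M)} (hC : IsClosed C)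
    (h : ∀ F : Finset M, ∃ 𝒯 : Set (ExpansionSpace R M), 𝒯.Finite ∧
      ∀ S ∈ C, ∃ T ∈ 𝒯, AgreeOn F T S) : IsCompact C := by
  rw [isCompact_iff_ultrafilter_le_nhds]
  intro f hf
  let S : ExpansionSpace R M := fun i y => ∀ᶠ T : ExpansionSpace R M in f, T i y
  have hS : ∀ F : Finset M, ∀ᶠ T in f, AgreeOn F S T := by
    intro F
    obtain ⟨𝒯, hfin, h𝒯⟩ := h F
    have h1 : (⋃ T ∈ 𝒯, {T' | AgreeOn F T T'}) ∈ f :=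
      Filter.mem_of_superset (Filter.le_principal_iff.1 hf) fun T' hT' => by
        obtain ⟨T, hT, hTT⟩ := h𝒯 T' hT'
        exact Set.mem_biUnion hT hTT
    obtain ⟨T, -, hT⟩ := (Ultrafilter.finite_biUnion_mem_iff hfin).1 h1
    have h2 : AgreeOn F S T := by
      intro i y hy
      constructor
      · intro (h3 : ∀ᶠ T : ExpansionSpace R M in f, T i y)
        obtain ⟨T', h4, h5⟩ := (h3.and hT).exists
        exact (h5 i y hy).2 h4
      · intro h3
        refine Filter.mem_of_superset hT fun T' h4 => ?_
        exact (h4 i y hy).1 h3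
    exact Filter.mem_of_superset hT fun T' h3 i y hy => (h2 i y hy).trans (h3 i y hy)
  have hle : (f : Filter _) ≤ nhds S := by
    intro U hU
    obtain ⟨F, hF⟩ := expansion_mem_nhds.1 hU
    exact Filter.mem_of_superset (hS F) hF
  refine ⟨S, ?_, hle⟩
  exact isClosed_iff_ultrafilter.1 hC S f hle (Filter.le_principal_iff.1 hf)

theorem mem_orbitClosure {M : Type} [L.Structure M] [R.Structure M] {S : ExpansionSpace R M} :
    S ∈ orbitClosure L R M ↔
      ∀ F : Finset M, ∃ g : M ≃[L] M, AgreeOn F S (g • expansionPoint R M) := by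
  change S ∈ closure _ ↔ _
  rw [mem_closure_expansion]
  refine forall_congr' fun F => ⟨?_, ?_⟩
  · rintro ⟨_, ⟨g, rfl⟩, h⟩
    exact ⟨g, h⟩
  · rintro ⟨g, h⟩
    exact ⟨_, ⟨g, rfl⟩, h⟩

theorem expansionPoint_mem_orbitClosure {M : Type} [L.Structure M] [R.Structure M] :
    expansionPoint R M ∈ orbitClosure L R M :=
  subset_closure (MulAction.mem_orbit_self _)

/-! ### Points of X* and the age of the expansion -/

section Age

variable [R.IsRelational] {M : Type} [L.Structure M] [R.Structure M]

/-- Expansions induced by points of `X*` are in the age of the expanded structure. -/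
theorem expand_pull_mem_age {A : Bundled.{0} L.Structure} [Finite A] (a : A ↪[L] M)
    {S : ExpansionSpace R M} (hS : S ∈ orbitClosure L R M) :
    expand A (pull S a) ∈ (L.sum R).age M := by
  classical
  obtain ⟨g, hg⟩ := mem_orbitClosure.1 hS (Set.finite_range a).toFinset
  rw [pull_eq_of_agreeOn hg fun x => by simp, pull_smul]
  refine ⟨?_, ⟨?_⟩⟩
  · have : Finite (expand A (pull (expansionPoint R M) ((g⁻¹ : M ≃[L] M) ∘ a))) := ‹Finite A›
    exact FG.of_finite
  · letI := pull (expansionPoint R M) ((g⁻¹ : M ≃[L] M) ∘ a)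
    let e : A ↪[L.sum R] M :=
      sumEmbedding ((g⁻¹ : M ≃[L] M).toEmbedding.comp a) fun n r y => Iff.rfl
    exact e

/-- Every expansion in the age of the expanded structure is induced by a translate of it. -/
theorem exists_pull_eq_of_expand_mem_age (hF : L.IsUltrahomogeneous M)
    {A : Bundled.{0} L.Structure} [Finite A] (a : A ↪[L] M) {σ : R.Structure A}
    (hσ : expand A σ ∈ (L.sum R).age M) :
    ∃ g : M ≃[L] M, pull (g • expansionPoint R M) a = σ := by
  obtain ⟨-, ⟨e⟩⟩ := hσ
  let := σ
  let e' : A ↪[L.sum R] M := e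
  obtain ⟨g, hg⟩ := exists_equiv_of_embeddings hF FG.of_finite a (reductEmbedding e')
  refine ⟨g, structure_ext_of_isRelational fun n r y => ?_⟩
  have h1 : (a : A → M) = g ∘ reductEmbedding e' := funext fun x => (hg x).symm
  rw [h1, pull_smul_comp]
  exact relMap_embedding e' r y

theorem isCompact_orbitClosure (hF : IsFraisseStructure L M)
    (hpre : IsPrecompactExpansion L R M) :
    IsCompact (orbitClosure L R M : Set (ExpansionSpace R M)) := by
  refine isCompact_expansion isClosed_closure fun F => ?_
  let N : L.Substructure M := Substructure.closure L (F : Set M)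
  have hN : N.FG := Substructure.fg_closure F.finite_toSet
  have : Finite N := hF.locallyFinite N hN
  let A : Bundled.{0} L.Structure := ⟨N, inferInstance⟩
  have : Finite A := ‹Finite N›
  let a : A ↪[L] M := N.subtype
  have hfin := hpre A (age.fg_substructure hN)
  have : Nonempty (ExpansionSpace R M) := ⟨expansionPoint R M⟩
  -- One representative per expansion of the substructure generated by `F`; the value is arbitrary
  -- if no point induces `σ`.
  let T : R.Structure A → ExpansionSpace R M := fun σ =>
    Classical.epsilon fun S => pull S a = σ
  refine ⟨T '' _, hfin.image T, fun S hS => ⟨_, ⟨_, expand_pull_mem_age a hS, rfl⟩, ?_⟩⟩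
  have h1 : pull (T (pull S a)) a = pull S a :=
    Classical.epsilon_spec (p := fun S' => pull S' a = pull S a) ⟨S, rfl⟩
  exact agreeOn_of_pull_eq h1 fun x hx => ⟨⟨x, Substructure.subset_closure hx⟩, rfl⟩

end Age

/-- Makes the flows built below admissible as targets of universality, whatever the universe `w`. -/
instance small_expansionSpace [Countable R.Symbols] {M : Type} :
    Small.{w} (ExpansionSpace R M) := by
  have : Countable (Σ n, R.Relations n) :=
    Function.Injective.countable (f := fun i => (Sum.inr i : R.Symbols)) Sum.inr_injective
  have : ∀ i : Σ n, R.Relations n, Small.{w} ((Fin i.1 → M) → Prop) := fun i => inferInstance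
  unfold ExpansionSpace
  exact small_Pi _

end Structures

/-! ### Minimality and the expansion property -/

section Minimality

open CategoryTheory (Bundled)
open FirstOrder Language Structure

variable {L : FirstOrder.Language.{u, v}} {R : FirstOrder.Language.{u₂, v₂}} [R.IsRelational]
  {M : Type} [L.Structure M] [R.Structure M]

/-- By minimality every point of X* induces every admissible expansion of `A` somewhere in `M`;
compactness of X* bounds where, and the bounding finite set generates `B`. -/
theorem expansionProperty_of_isMinimal (hF : IsFraisseStructure L M)
    (hpre : IsPrecompactExpansion L R M)
    (hmin : MulAction.IsMinimal (M ≃[L] M) (orbitClosure L R M)) : ExpansionProperty L R M := by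
  classical
  intro A hA
  have hfinA := finite_of_mem_age hF hA
  obtain ⟨a⟩ := hA.2
  have hmeet : ∀ S ∈ orbitClosure L R M, ∀ σ : R.Structure A, expand A σ ∈ (L.sum R).age M →
      ∃ h : A ↪[L] M, pull S h = σ := by
    intro S hS σ hσ
    obtain ⟨g₀, hg₀⟩ := exists_pull_eq_of_expand_mem_age hF.ultrahomogeneous a hσ
    have hT : g₀ • expansionPoint R M ∈ orbitClosure L R M :=
      (orbitClosure L R M).smul_mem g₀ expansionPoint_mem_orbitClosure
    have h1 := hmin.dense_orbit ⟨S, hS⟩ ⟨_, hT⟩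
    rw [closure_subtype, mem_closure_expansion] at h1
    obtain ⟨_, ⟨_, ⟨g, rfl⟩, rfl⟩, h3⟩ := h1 (Set.finite_range a).toFinset
    have h4 : pull (g₀ • expansionPoint R M) a = pull (g • S) a :=
      pull_eq_of_agreeOn h3 fun x => by simp
    exact ⟨(g⁻¹ : M ≃[L] M).toEmbedding.comp a, h4.symm.trans hg₀⟩
  obtain ⟨F, hFmeet⟩ : ∃ F : Finset M, ∀ S ∈ (orbitClosure L R M : Set (ExpansionSpace R M)),
      ∀ σ : R.Structure A, expand A σ ∈ (L.sum R).age M →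
        ∃ h : A ↪[L] M, (∀ x, h x ∈ F) ∧ pull S h = σ := by
    refine (isCompact_orbitClosure hF hpre).induction_on (p := fun s => ∃ F : Finset M, ∀ S ∈ s,
      ∀ σ : R.Structure A, expand A σ ∈ (L.sum R).age M →
        ∃ h : A ↪[L] M, (∀ x, h x ∈ F) ∧ pull S h = σ) ⟨∅, fun _ h => h.elim⟩ ?_ ?_ ?_
    · rintro s t hst ⟨F, hF⟩
      exact ⟨F, fun S hS => hF S (hst hS)⟩
    · rintro s t ⟨F₁, h₁⟩ ⟨F₂, h₂⟩
      refine ⟨F₁ ∪ F₂, ?_⟩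
      rintro S (hS | hS) σ hσ
      · obtain ⟨h, h3, h4⟩ := h₁ S hS σ hσ
        exact ⟨h, fun x => Finset.mem_union_left _ (h3 x), h4⟩
      · obtain ⟨h, h3, h4⟩ := h₂ S hS σ hσ
        exact ⟨h, fun x => Finset.mem_union_right _ (h3 x), h4⟩
    · intro S hS
      choose h hh using hmeet S hS
      -- By precompactness finitely many embeddings suffice at `S`, and points agreeing with `S` on
      -- their ranges can use the same ones.
      have hfin : (⋃ σ : {σ : R.Structure A | expand A σ ∈ (L.sum R).age M},
          Set.range (h σ.1 σ.2)).Finite := by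
        have := (hpre A hA).to_subtype
        exact Set.finite_iUnion fun σ => Set.finite_range _
      have hmem : ∀ σ hσ x, h σ hσ x ∈ hfin.toFinset := fun σ hσ x =>
        hfin.mem_toFinset.2 (Set.mem_iUnion.2 ⟨⟨σ, hσ⟩, x, rfl⟩)
      refine ⟨_, mem_nhdsWithin_of_mem_nhds
        (expansion_mem_nhds.2 ⟨hfin.toFinset, fun T hT => hT⟩), hfin.toFinset, ?_⟩
      intro T hT σ hσ
      exact ⟨h σ hσ, hmem σ hσ,
        (pull_eq_of_agreeOn hT (hmem σ hσ)).symm.trans (hh σ hσ)⟩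
  let N : L.Substructure M := Substructure.closure L (F : Set M)
  have hN : N.FG := Substructure.fg_closure F.finite_toSet
  have : Finite N := hF.locallyFinite N hN
  let B : Bundled.{0} L.Structure := ⟨N, inferInstance⟩
  have : Finite B := ‹Finite N›
  let b : B ↪[L] M := N.subtype
  refine ⟨B, age.fg_substructure hN, fun σ τ hσ hτ => ?_⟩
  obtain ⟨g, rfl⟩ := exists_pull_eq_of_expand_mem_age hF.ultrahomogeneous b hτ
  obtain ⟨h, h1, rfl⟩ := hFmeet _ ((orbitClosure L R M).smul_mem g expansionPoint_mem_orbitClosure)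
    σ hσ
  let e : A ↪[L] B := h.codRestrict N fun x => Substructure.subset_closure (h1 x)
  let := pull (g • expansionPoint R M) h
  let := pull (g • expansionPoint R M) b
  let e' : A ↪[L.sum R] B := sumEmbedding e fun n r y => Iff.rfl
  exact ⟨e'⟩

theorem isMinimal_of_expansionProperty (hF : IsFraisseStructure L M)
    (hexp : ExpansionProperty L R M) :
    MulAction.IsMinimal (M ≃[L] M) (orbitClosure L R M) where
  dense_orbit := by
    classical
    rintro ⟨S, hS⟩
    -- It suffices to approximate R* by translates of `S`: the expansion of `A` by R* embeds into
    -- that of `B` by `S`, and some `g` moves the image of `A` back into place.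
    have hpoint : expansionPoint R M ∈ closure (MulAction.orbit (M ≃[L] M) S) := by
      rw [mem_closure_expansion]
      intro F
      let N : L.Substructure M := Substructure.closure L (F : Set M)
      have hN : N.FG := Substructure.fg_closure F.finite_toSet
      have : Finite N := hF.locallyFinite N hN
      let A : Bundled.{0} L.Structure := ⟨N, inferInstance⟩
      have : Finite A := ‹Finite N›
      let a : A ↪[L] M := N.subtype
      obtain ⟨B, hB, hAB⟩ := hexp A (age.fg_substructure hN)
      have := finite_of_mem_age hF hB
      obtain ⟨b⟩ := hB.2
      obtain ⟨e⟩ := hAB _ _ (expand_pull_mem_age a expansionPoint_mem_orbitClosure)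
        (expand_pull_mem_age b hS)
      let := pull (expansionPoint R M) a
      let := pull S b
      let e' : A ↪[L.sum R] B := e
      obtain ⟨g, hg⟩ := exists_equiv_of_embeddings hF.ultrahomogeneous FG.of_finite a
        (b.comp (reductEmbedding e'))
      refine ⟨g • S, ⟨g, rfl⟩, ?_⟩
      have h1 : pull (expansionPoint R M) a = pull (g • S) a := by
        have h2 : (a : A → M) = g ∘ (b.comp (reductEmbedding e')) :=
          funext fun x => (hg x).symm
        have h3 : pull (g • S) a = pull S (b.comp (reductEmbedding e')) :=
          (congrArg (pull (g • S)) h2).trans (pull_smul_comp g S _)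
        rw [h3]
        exact structure_ext_of_isRelational fun n r y => (relMap_embedding e' r y).symm
      exact agreeOn_of_pull_eq h1 fun x hx => ⟨⟨x, Substructure.subset_closure hx⟩, rfl⟩
    have hle : (orbitClosure L R M : Set (ExpansionSpace R M)) ⊆
        closure (MulAction.orbit (M ≃[L] M) S) := by
      refine closure_minimal ?_ isClosed_closure
      rintro _ ⟨g, rfl⟩
      exact (closureOrbit (M ≃[L] M) S).smul_mem g hpoint
    intro T
    rw [closure_subtype]
    refine closure_mono ?_ (hle T.2)
    rintro _ ⟨g, rfl⟩
    exact ⟨_, ⟨g, rfl⟩, rfl⟩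

end Minimality

/-! ### The Ramsey property in terms of embeddings -/

section Ramsey

open CategoryTheory (Bundled)
open FirstOrder Language Structure

variable {L : FirstOrder.Language.{u, v}}

/-- The arrow relation for colourings of embeddings. -/
def EmbArrow (L : FirstOrder.Language.{u, v}) (A B C : Type) [L.Structure A] [L.Structure B]
    [L.Structure C] (k : ℕ) : Prop :=
  ∀ c : (A ↪[L] C) → Fin k, ∃ f : B ↪[L] C, ∀ e₁ e₂ : A ↪[L] B, c (f.comp e₁) = c (f.comp e₂)

theorem range_mem_copies {A C : Type} [L.Structure A] [L.Structure C] (e : A ↪[L] C) :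
    e.toHom.range ∈ Copies L A C := ⟨e.equivRange⟩

theorem exists_embedding_of_mem_copies {A C : Type} [L.Structure A] [L.Structure C]
    {N : L.Substructure C} (h : N ∈ Copies L A C) : ∃ e : A ↪[L] C, e.toHom.range = N := by
  obtain ⟨i⟩ := h
  refine ⟨N.subtype.comp i.toEmbedding, SetLike.ext fun x => ?_⟩
  rw [Hom.mem_range]
  constructor
  · rintro ⟨y, rfl⟩
    exact (i y).2
  · intro hx
    refine ⟨i.symm ⟨x, hx⟩, ?_⟩
    change ((i (i.symm ⟨x, hx⟩) : N) : C) = x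
    rw [Language.Equiv.apply_symm_apply]

/-- Colour an embedding by the colour of its range; this direction needs no rigidity. -/
theorem EmbArrow.arrow {A B C : Type} [L.Structure A] [L.Structure B] [L.Structure C] {k : ℕ}
    (h : EmbArrow L A B C k) : Arrow L A B C k := by
  intro c
  obtain ⟨f, hf⟩ := h fun e => c ⟨_, range_mem_copies e⟩
  refine ⟨_, range_mem_copies f, ?_⟩
  have hc : ∀ A₁ : Copies L A C, A₁.1 ≤ f.toHom.range → ∃ e : A ↪[L] B,
      c ⟨_, range_mem_copies (f.comp e)⟩ = c A₁ := by
    rintro ⟨N, hN⟩ hle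
    obtain ⟨e, rfl⟩ := exists_embedding_of_mem_copies hN
    let e' : A ↪[L] f.toHom.range := e.codRestrict _ fun x => hle (Hom.mem_range_self e.toHom x)
    have h1 : f.comp (f.equivRange.symm.toEmbedding.comp e') = e := by
      ext x
      have h2 : f (f.equivRange.symm (e' x)) = (f.equivRange (f.equivRange.symm (e' x)) : C) := rfl
      change f (f.equivRange.symm (e' x)) = e x
      rw [h2, Language.Equiv.apply_symm_apply]
      rfl
    exact ⟨f.equivRange.symm.toEmbedding.comp e', by simp only [h1]⟩
  intro A₁ A₂ h₁ h₂
  obtain ⟨e₁, h₁⟩ := hc A₁ h₁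
  obtain ⟨e₂, h₂⟩ := hc A₂ h₂
  rw [← h₁, ← h₂]
  exact hf e₁ e₂

/-- Embeddings with the same range differ by an automorphism of `A`, which rigidity makes trivial.
-/
theorem embedding_eq_of_range_eq {A C : Type} [L.Structure A] [L.Structure C]
    (hA : ∀ f : A ≃[L] A, f = Language.Equiv.refl L A) {e₁ e₂ : A ↪[L] C}
    (h : e₁.toHom.range = e₂.toHom.range) : e₁ = e₂ := by
  let e' : A ↪[L] e₂.toHom.range := e₁.codRestrict _ fun x => h ▸ Hom.mem_range_self e₁.toHom x
  have hsurj : Function.Surjective e' := by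
    rintro ⟨y, hy⟩
    obtain ⟨x, hx⟩ := Hom.mem_range.1 (h ▸ hy : y ∈ e₁.toHom.range)
    exact ⟨x, Subtype.ext hx⟩
  let i : A ≃[L] e₂.toHom.range :=
    { _root_.Equiv.ofBijective e' ⟨e'.injective, hsurj⟩ with
      map_fun' := e'.map_fun'
      map_rel' := e'.map_rel' }
  have h1 := hA (e₂.equivRange.symm.comp i)
  ext x
  have h2 : e₂.equivRange.symm (i x) = x := DFunLike.congr_fun h1 x
  have h3 : i x = e₂.equivRange x := by rw [← h2, Language.Equiv.apply_symm_apply, h2]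
  exact congrArg Subtype.val h3

theorem Arrow.embArrow {A B C : Type} [L.Structure A] [L.Structure B] [L.Structure C] {k : ℕ}
    (hA : ∀ f : A ≃[L] A, f = Language.Equiv.refl L A) (h : Arrow L A B C k) : EmbArrow L A B C k := by
  intro c
  choose e he using fun N : Copies L A C => exists_embedding_of_mem_copies N.2
  obtain ⟨B', hB', hmono⟩ := h fun N => c (e N)
  obtain ⟨f, rfl⟩ := exists_embedding_of_mem_copies hB'
  refine ⟨f, fun e₁ e₂ => ?_⟩
  have hle : ∀ e' : A ↪[L] B, (f.comp e').toHom.range ≤ f.toHom.range := by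
    intro e' x hx
    obtain ⟨y, rfl⟩ := Hom.mem_range.1 hx
    exact Hom.mem_range_self f.toHom (e' y)
  have hc : ∀ e' : A ↪[L] B, e ⟨_, range_mem_copies (f.comp e')⟩ = f.comp e' := fun e' =>
    embedding_eq_of_range_eq hA (he _)
  have := hmono ⟨_, range_mem_copies (f.comp e₁)⟩ ⟨_, range_mem_copies (f.comp e₂)⟩
    (hle e₁) (hle e₂)
  rwa [hc, hc] at this

theorem EmbArrow.mono {A B C D : Type} [L.Structure A] [L.Structure B] [L.Structure C]
    [L.Structure D] {k : ℕ} (h : EmbArrow L A B C k) (i : C ↪[L] D) : EmbArrow L A B D k := by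
  intro c
  obtain ⟨f, hf⟩ := h fun e => c (i.comp e)
  exact ⟨i.comp f, hf⟩

/-- If an arrow relation holds in `M` then by compactness it holds in a finitely generated
substructure of `M`. -/
theorem EmbArrow.exists_finset {A B M : Type} [L.Structure A] [L.Structure B] [L.Structure M]
    [Finite A] [Finite B] {k : ℕ} (h : EmbArrow L A B M k) :
    ∃ F : Finset M, EmbArrow L A B (Substructure.closure L (F : Set M)) k := by
  classical
  by_contra! hno
  have hbad : ∀ F : Finset M, ∃ c : (A ↪[L] Substructure.closure L (F : Set M)) → Fin k,
      ∀ f : B ↪[L] Substructure.closure L (F : Set M), ∃ e₁ e₂ : A ↪[L] B,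
        c (f.comp e₁) ≠ c (f.comp e₂) := by
    intro F
    have := hno F
    unfold EmbArrow at this
    push Not at this
    exact this
  choose c hc using hbad
  -- The bad colourings of the finitely generated substructures have an ultralimit `j`, a colouring
  -- over `M`. A copy of `B` good for `j` lies in some substructure whose bad colouring agrees with
  -- `j` on it.
  let U : Ultrafilter (Finset M) := Ultrafilter.of Filter.atTop
  have hlarge : ∀ {D : Type} [L.Structure D] [Finite D] (e : D ↪[L] M), ∀ᶠ F : Finset M in U,
      ∃ e' : D ↪[L] Substructure.closure L (F : Set M),
        (Substructure.subtype _).comp e' = e := by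
    intro D _ _ e
    refine Ultrafilter.of_le _ (Filter.mem_of_superset
      (Filter.mem_atTop (Set.finite_range e).toFinset) fun F hF => ?_)
    exact ⟨e.codRestrict _ fun x => Substructure.subset_closure (hF (by simp)), rfl⟩
  have hlim : ∀ e : A ↪[L] M, ∃ j : Fin k, ∀ᶠ F : Finset M in U,
      ∀ e' : A ↪[L] Substructure.closure L (F : Set M),
        (Substructure.subtype _).comp e' = e → c F e' = j := by
    intro e
    have h1 : ∀ᶠ F : Finset M in U, ∃ j : Fin k,
        ∀ e' : A ↪[L] Substructure.closure L (F : Set M),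
          (Substructure.subtype _).comp e' = e → c F e' = j := by
      filter_upwards [hlarge e] with F ⟨e', he'⟩
      refine ⟨c F e', fun e'' he'' => ?_⟩
      congr 1
      ext x
      exact DFunLike.congr_fun (he''.trans he'.symm) x
    exact Ultrafilter.eventually_exists_iff.1 h1
  choose j hj using hlim
  obtain ⟨f, hf⟩ := h j
  have : Finite (A ↪[L] B) := DFunLike.finite _
  have h2 : ∀ᶠ F : Finset M in U, ∀ e : A ↪[L] B,
      ∀ e' : A ↪[L] Substructure.closure L (F : Set M),
        (Substructure.subtype _).comp e' = f.comp e → c F e' = j (f.comp e) :=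
    Filter.eventually_all.2 fun e => hj (f.comp e)
  obtain ⟨F, hF, f', rfl⟩ := (h2.and (hlarge f)).exists
  obtain ⟨e₁, e₂, hne⟩ := hc F f'
  exact hne ((hF e₁ _ rfl).trans ((hf e₁ e₂).trans (hF e₂ _ rfl).symm))

theorem ramseyProperty_age_iff {M : Type} [L.Structure M] (hM : IsFraisseStructure L M)
    (hrigid : ConsistsOfRigid (L.age M)) :
    RamseyProperty (L.age M) ↔
      ∀ k : ℕ, ∀ A ∈ L.age M, ∀ B ∈ L.age M, EmbArrow L A B M k := by
  constructor
  · intro h k A hA B hB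
    obtain ⟨C, hC, hABC⟩ := h k A hA B hB
    exact (hABC.embArrow (hrigid A hA)).mono hC.2.some
  · intro h k A hA B hB
    have := finite_of_mem_age hM hA
    have := finite_of_mem_age hM hB
    obtain ⟨F, hF⟩ := (h k A hA B hB).exists_finset
    exact ⟨⟨_, inferInstance⟩, age.fg_substructure (Substructure.fg_closure F.finite_toSet),
      hF.arrow⟩

end Ramsey

/-! ### Extreme amenability and universality -/

section ExtremeAmenability

open CategoryTheory (Bundled)
open FirstOrder Language Structure
open scoped Uniformity Topology

/-- Tube lemma: compactness of `Y` makes continuity of the action at 1 uniform in `y`. -/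
theorem eventually_forall_smul_close {G : Type u} [Group G] [TopologicalSpace G] {Y : Type v}
    [UniformSpace Y] [CompactSpace Y] [MulAction G Y] [ContinuousSMul G Y] {V : Set (Y × Y)}
    (hV : V ∈ 𝓤 Y) : ∀ᶠ g in 𝓝 (1 : G), ∀ y : Y, (y, g • y) ∈ V := by
  have h1 : ∀ᶠ g in 𝓝 (1 : G), ∀ y ∈ (Set.univ : Set Y), (y, g • y) ∈ V := by
    refine isCompact_univ.eventually_forall_of_forall_eventually fun y _ => ?_
    have hc : Continuous fun p : G × Y => (p.2, p.1 • p.2) := by fun_prop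
    refine hc.continuousAt.preimage_mem_nhds (x := (1, y)) ?_
    simp only [one_smul]
    exact nhds_le_uniformity y hV
  exact h1.mono fun g hg y => hg y trivial

/-- Up to a small error, s⁻¹y₀ depends only on the restriction of `s` to a finitely generated `A`.
Colouring embeddings of `A` by a finite net of `Y` and applying the arrow relation gives almost
fixed points for finitely many automorphisms; compactness yields a fixed point. -/
theorem exists_fixedPoint_of_ramsey {L : FirstOrder.Language.{u, v}} {M : Type} [L.Structure M]
    (hM : IsFraisseStructure L M)
    (hR : ∀ k : ℕ, ∀ A ∈ L.age M, ∀ B ∈ L.age M, EmbArrow L A B M k)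
    (Y : Type w) [TopologicalSpace Y] [CompactSpace Y] [T2Space Y] [Nonempty Y]
    [MulAction (M ≃[L] M) Y] [ContinuousSMul (M ≃[L] M) Y] :
    ∃ y : Y, ∀ s : M ≃[L] M, s • y = y := by
  classical
  let := uniformSpaceOfCompactR1 (γ := Y)
  obtain ⟨y₀⟩ := ‹Nonempty Y›
  have happrox : ∀ V ∈ 𝓤 Y, ∀ S₀ : Finset (M ≃[L] M), ∃ y : Y, ∀ s ∈ S₀, (s • y, y) ∈ V := by
    intro V hV S₀
    obtain ⟨V', hV', hsymm', hVV'⟩ := comp_symm_mem_uniformity_sets hV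
    obtain ⟨W, hW, hsymm, hWW⟩ := comp_symm_mem_uniformity_sets hV'
    obtain ⟨F, hF⟩ := aut_mem_nhds.1 (eventually_forall_smul_close (G := M ≃[L] M) hW)
    obtain ⟨t, ht, htc⟩ := isCompact_univ.totallyBounded (α := Y) W hW
    obtain ⟨k, ⟨z⟩⟩ := ht.to_subtype.exists_equiv_fin
    let N : L.Substructure M := Substructure.closure L (F : Set M)
    have hN : N.FG := Substructure.fg_closure F.finite_toSet
    let A : Bundled.{0} L.Structure := ⟨N, inferInstance⟩
    let a : A ↪[L] M := N.subtype
    -- `B` will contain s⁻¹A for all s in S₀, and `A` itself because of the 1. If `t` extends the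
    -- monochromatic copy of `B`, then ts⁻¹ and t get the same colour on `A`, so st⁻¹y₀ is close to
    -- t⁻¹y₀.
    let T : Finset (M ≃[L] M) := insert 1 S₀
    let F' : Finset M := T.biUnion fun s => F.image (s⁻¹ : M ≃[L] M)
    let N' : L.Substructure M := Substructure.closure L (F' : Set M)
    have hN' : N'.FG := Substructure.fg_closure F'.finite_toSet
    let B : Bundled.{0} L.Structure := ⟨N', inferInstance⟩
    have hext : ∀ e : A ↪[L] M, ∃ s : M ≃[L] M, ∀ x, s (a x) = e x := fun e =>
      exists_equiv_of_embeddings hM.ultrahomogeneous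
        ((Substructure.fg_iff_structure_fg _).1 hN) e a
    choose ext hext using hext
    have hcol : ∀ y : Y, ∃ i : Fin k, (y, (z.symm i : Y)) ∈ W := by
      intro y
      obtain ⟨x, hx, hyx⟩ := Set.mem_iUnion₂.1 (htc (Set.mem_univ y))
      exact ⟨z ⟨x, hx⟩, by simpa using hyx⟩
    choose col hcol using hcol
    obtain ⟨f, hf⟩ := hR k A (age.fg_substructure hN) B (age.fg_substructure hN')
      fun e => col ((ext e)⁻¹ • y₀)
    obtain ⟨t, ht⟩ := exists_equiv_of_embeddings hM.ultrahomogeneous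
        ((Substructure.fg_iff_structure_fg _).1 hN') f N'.subtype
    have hclose : ∀ (e : A ↪[L] M) (s : M ≃[L] M), (∀ x, s (a x) = e x) →
        (s⁻¹ • y₀, (z.symm (col ((ext e)⁻¹ • y₀)) : Y)) ∈ V' := by
      intro e s hs
      refine hWW ⟨(ext e)⁻¹ • y₀, ?_, hcol _⟩
      have h1 := hF ((ext e)⁻¹ * s) (fun x hx => by
        have h2 := hs ⟨x, Substructure.subset_closure hx⟩
        rw [← hext e] at h2
        change (ext e)⁻¹ (s x) = x
        rw [show s x = ext e x from h2, aut_inv_apply_self]) (s⁻¹ • y₀)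
      rwa [← mul_smul, mul_assoc, mul_inv_cancel, mul_one] at h1
    have hemb : ∀ s ∈ T, ∃ e : A ↪[L] B, ∀ x : A, ((e x : N') : M) = (s⁻¹ : M ≃[L] M) (a x) := by
      intro s hs
      have hle : N ≤ N'.comap (s⁻¹ : M ≃[L] M).toHom := by
        refine Substructure.closure_le.2 fun x hx => Substructure.subset_closure ?_
        exact Finset.mem_biUnion.2 ⟨s, hs, Finset.mem_image_of_mem _ hx⟩
      exact ⟨((s⁻¹ : M ≃[L] M).toEmbedding.comp a).codRestrict N' fun x => hle x.2, fun x => rfl⟩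
    refine ⟨t⁻¹ • y₀, fun s hs => ?_⟩
    obtain ⟨e₁, he₁⟩ := hemb s (Finset.mem_insert_of_mem hs)
    obtain ⟨e₂, he₂⟩ := hemb 1 (Finset.mem_insert_self _ _)
    have h1 := hclose (f.comp e₁) (t * s⁻¹) fun x => by
      rw [aut_mul_apply, ← he₁ x]
      exact ht (e₁ x)
    have h2 := hclose (f.comp e₂) t fun x => by
      have h3 : a x = ((e₂ x : N') : M) := (he₂ x).symm
      rw [h3]
      exact ht (e₂ x)
    rw [hf e₁ e₂] at h1
    refine hVV' ⟨_, ?_, SetRel.symm V' h2⟩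
    rwa [mul_inv_rev, inv_inv, mul_smul] at h1
  -- Closed entourages make the sets of almost fixed points closed.
  let ι := {V : Set (Y × Y) // V ∈ 𝓤 Y ∧ IsClosed V} × Finset (M ≃[L] M)
  let K : ι → Set Y := fun i => {y | ∀ s ∈ i.2, (s • y, y) ∈ i.1.1}
  have hKc : ∀ i, IsClosed (K i) := by
    intro i
    have : K i = ⋂ s ∈ i.2, {y | (s • y, y) ∈ i.1.1} := by ext; simp [K]
    rw [this]
    exact isClosed_biInter fun s _ => i.1.2.2.preimage (by fun_prop)
  have : Nonempty ι := ⟨⟨⟨Set.univ, Filter.univ_mem, isClosed_univ⟩, ∅⟩⟩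
  obtain ⟨y, hy⟩ := IsCompact.nonempty_iInter_of_directed_nonempty_isCompact_isClosed K
    (by
      rintro ⟨⟨V, hV, hVc⟩, S⟩ ⟨⟨V', hV', hVc'⟩, S'⟩
      refine ⟨⟨⟨V ∩ V', Filter.inter_mem hV hV', hVc.inter hVc'⟩, S ∪ S'⟩, ?_, ?_⟩
      · exact fun y hy s hs => (hy s (Finset.mem_union_left _ hs)).1
      · exact fun y hy s hs => (hy s (Finset.mem_union_right _ hs)).2)
    (fun i => happrox _ i.1.2.1 _) (fun i => (hKc i).isCompact) hKc
  refine ⟨y, fun s => eq_of_uniformity_basis uniformity_hasBasis_closed fun {V} hV => ?_⟩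
  exact Set.mem_iInter.1 hy ⟨⟨V, hV⟩, {s}⟩ s (Finset.mem_singleton_self s)

end ExtremeAmenability

/-! ### Universality from the Ramsey property -/

section Universality

open CategoryTheory (Bundled)
open FirstOrder Language Structure
open scoped Uniformity Topology

variable {L : FirstOrder.Language.{u, v}} {R : FirstOrder.Language.{u₂, v₂}}
  {M : Type} [L.Structure M] [R.Structure M]

variable (L R M) in
/-- The inclusion of the automorphism group of an expansion into that of the reduct. -/
def reductHom : (M ≃[L.sum R] M) →* (M ≃[L] M) where
  toFun := reductEquiv
  map_one' := rfl
  map_mul' _ _ := rfl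

theorem continuous_reductHom : Continuous (reductHom L R M) := by
  rw [continuous_iff_continuousAt]
  intro g U hU
  obtain ⟨F, hF⟩ := aut_mem_nhds.1 hU
  exact Filter.mem_map.2 (aut_mem_nhds.2 ⟨F, fun h hh => hF _ hh⟩)

theorem exists_fixedPoint_reduct_of_ramsey (hM : IsFraisseStructure (L.sum R) M)
    (hR : ∀ k : ℕ, ∀ A ∈ (L.sum R).age M, ∀ B ∈ (L.sum R).age M, EmbArrow (L.sum R) A B M k)
    (Y : Type w) [TopologicalSpace Y] [CompactSpace Y] [T2Space Y] [Nonempty Y]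
    [MulAction (M ≃[L] M) Y] [ContinuousSMul (M ≃[L] M) Y] :
    ∃ y : Y, ∀ s : M ≃[L.sum R] M, reductEquiv s • y = y := by
  let := MulAction.compHom Y (reductHom L R M)
  have : ContinuousSMul (M ≃[L.sum R] M) Y := ⟨by
    change Continuous fun p : (M ≃[L.sum R] M) × Y => reductHom L R M p.1 • p.2
    exact (continuous_reductHom.comp continuous_fst).smul continuous_snd⟩
  exact exists_fixedPoint_of_ramsey hM hR Y

/-- Translates of the expansion agreeing on a large finite set move a point fixed by the
automorphisms of the expansion to nearby points. -/
theorem exists_finset_forall_smul_close [R.IsRelational] (hF : IsFraisseStructure L M)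
    (hM : IsFraisseStructure (L.sum R) M) {Y : Type w} [UniformSpace Y] [CompactSpace Y]
    [MulAction (M ≃[L] M) Y] [ContinuousSMul (M ≃[L] M) Y] {y : Y}
    (hy : ∀ s : M ≃[L.sum R] M, reductEquiv s • y = y) {V : Set (Y × Y)} (hV : V ∈ 𝓤 Y) :
    ∃ F : Finset M, ∀ g h : M ≃[L] M,
      AgreeOn F (g • expansionPoint R M) (h • expansionPoint R M) → (g • y, h • y) ∈ V := by
  obtain ⟨F, hFV⟩ := aut_mem_nhds.1 (eventually_forall_smul_close (G := M ≃[L] M) hV)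
  let N : L.Substructure M := Substructure.closure L (F : Set M)
  have : Finite N := hF.locallyFinite N (Substructure.fg_closure F.finite_toSet)
  refine ⟨(Set.toFinite (N : Set M)).toFinset, fun g h hgh => ?_⟩
  let a : N ↪[L] M := N.subtype
  have h1 : pull (g • expansionPoint R M) a = pull (h • expansionPoint R M) a :=
    pull_eq_of_agreeOn hgh fun x => by
      rw [Set.Finite.mem_toFinset]
      exact x.2
  let := pull (g • expansionPoint R M) a
  let e₁ : N ↪[L.sum R] M :=
    sumEmbedding ((g⁻¹ : M ≃[L] M).toEmbedding.comp a) fun n r x => Iff.rfl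
  let e₂ : N ↪[L.sum R] M :=
    sumEmbedding ((h⁻¹ : M ≃[L] M).toEmbedding.comp a) fun n r x => by
      have h2 : (pull (h • expansionPoint R M) a).RelMap r x ↔
        (pull (g • expansionPoint R M) a).RelMap r x := by rw [h1]
      exact h2
  obtain ⟨s, hs⟩ := exists_equiv_of_embeddings hM.ultrahomogeneous FG.of_finite e₂ e₁
  -- This automorphism fixes `F` pointwise, hence moves points little, and it sends gy to hsy = hy.
  have h3 := hFV (h * reductEquiv s * g⁻¹) (fun x hx => by
    have h4 : s ((g⁻¹ : M ≃[L] M) x) = (h⁻¹ : M ≃[L] M) x :=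
      hs ⟨x, Substructure.subset_closure hx⟩
    change h (s ((g⁻¹ : M ≃[L] M) x)) = x
    rw [h4, aut_apply_inv_self]) (g • y)
  rwa [mul_smul, inv_smul_smul, mul_smul, hy] at h3

theorem isUniversalFlow_of_ramsey [R.IsRelational] (hF : IsFraisseStructure L M)
    (hM : IsFraisseStructure (L.sum R) M)
    (hR : ∀ k : ℕ, ∀ A ∈ (L.sum R).age M, ∀ B ∈ (L.sum R).age M, EmbArrow (L.sum R) A B M k)
    [CompactSpace (orbitClosure L R M)] [MulAction.IsMinimal (M ≃[L] M) (orbitClosure L R M)] :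
    IsUniversalFlow.{0, v₂, w} (M ≃[L] M) (orbitClosure L R M) := by
  intro Y _ _ _ _ _ _ _
  let := uniformSpaceOfCompactR1 (γ := Y)
  obtain ⟨y, hy⟩ := exists_fixedPoint_reduct_of_ramsey hM hR Y
  let x₀ : orbitClosure L R M := ⟨expansionPoint R M, expansionPoint_mem_orbitClosure⟩
  let O : Set (orbitClosure L R M) := MulAction.orbit (M ≃[L] M) x₀
  have hO : Dense O := MulAction.dense_orbit _ x₀
  have hclose : ∀ V ∈ 𝓤 Y, ∃ F : Finset M, ∀ g h : M ≃[L] M,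
      AgreeOn F (g • expansionPoint R M) (h • expansionPoint R M) → (g • y, h • y) ∈ V :=
    fun V hV => exists_finset_forall_smul_close hF hM hy hV
  have hwd : ∀ g h : M ≃[L] M, g • x₀ = h • x₀ → g • y = h • y := by
    intro g h hgh
    have hgh' : g • expansionPoint R M = h • expansionPoint R M := congrArg Subtype.val hgh
    refine eq_of_uniformity fun {V} hV => ?_
    obtain ⟨F, hF⟩ := hclose V hV
    exact hF g h fun i z _ => by rw [hgh']
  let f : orbitClosure L R M → Y := fun x => (Classical.epsilon fun g : M ≃[L] M => g • x₀ = x) • y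
  have hf : ∀ g : M ≃[L] M, f (g • x₀) = g • y := fun g =>
    hwd _ _ (Classical.epsilon_spec (p := fun h : M ≃[L] M => h • x₀ = g • x₀) ⟨g, rfl⟩)
  -- By `hclose` the values of `f` near `x` form a Cauchy filter, and the compact space `Y` is
  -- complete.
  have hlim : ∀ x, ∃ z, Filter.Tendsto f (𝓝[O] x) (𝓝 z) := by
    intro x
    have : (𝓝[O] x).NeBot := mem_closure_iff_nhdsWithin_neBot.1 (hO x)
    refine cauchy_map_iff_exists_tendsto.1 (cauchy_iff'.2 ⟨inferInstance, fun V hV => ?_⟩)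
    obtain ⟨F, hF⟩ := hclose V hV
    refine ⟨f '' ({T | AgreeOn F x.1 T.1} ∩ O), Filter.image_mem_map ?_, ?_⟩
    · refine Filter.inter_mem (mem_nhdsWithin_of_mem_nhds ?_) self_mem_nhdsWithin
      exact continuous_subtype_val.continuousAt.preimage_mem_nhds
        (expansion_mem_nhds.2 ⟨F, fun T hT => hT⟩)
    · rintro _ ⟨_, ⟨h1, ⟨g, rfl⟩⟩, rfl⟩ _ ⟨_, ⟨h2, ⟨h, rfl⟩⟩, rfl⟩
      rw [hf, hf]
      exact hF g h fun i z hz => (h1 i z hz).symm.trans (h2 i z hz)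
  let π : orbitClosure L R M → Y := extendFrom O f
  have hπ : Continuous π := continuous_extendFrom hO hlim
  have hπO : ∀ g : M ≃[L] M, π (g • x₀) = g • y := by
    intro g
    obtain ⟨z, hz⟩ := hlim (g • x₀)
    have h1 : z = f (g • x₀) := by
      refine tendsto_nhds_unique (f := f) (hz.mono_left ?_) (tendsto_pure_nhds f (g • x₀))
      exact pure_le_nhdsWithin ⟨g, rfl⟩
    rw [← hf, ← h1]
    exact extendFrom_eq (hO _) hz
  have hπg : ∀ (g : M ≃[L] M) (x : orbitClosure L R M), π (g • x) = g • π x := by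
    intro g x
    have hc : IsClosed {x | π (g • x) = g • π x} := isClosed_eq (by fun_prop) (by fun_prop)
    refine closure_minimal ?_ hc (hO x)
    rintro _ ⟨h, rfl⟩
    change π (g • h • x₀) = g • π (h • x₀)
    rw [← mul_smul, hπO, hπO, mul_smul]
  have : Nonempty (orbitClosure L R M) := ⟨x₀⟩
  exact ⟨π, hπ, surjective_of_isMinimal hπ hπg, hπg⟩

end Universality

/-! ### The Ramsey property from universality -/

section Colourings

open CategoryTheory (Bundled)
open FirstOrder Language Structure

/-- The relational language with `k` relation symbols, all of arity `n`. -/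
@[reducible] def colourLanguage (n k : ℕ) : FirstOrder.Language.{0, 0} where
  Functions _ := Empty
  Relations m := {_j : Fin k // m = n}

/-- The `j`-th symbol of the language of colours. -/
def colourSymbol {n k : ℕ} (j : Fin k) : Σ m, (colourLanguage n k).Relations m := ⟨n, j, rfl⟩

instance finite_colourSymbols (n k : ℕ) : Finite (Σ m, (colourLanguage n k).Relations m) :=
  Finite.of_injective (fun i => i.2.1 : (Σ m, (colourLanguage n k).Relations m) → Fin k) <| by
    rintro ⟨_, j, rfl⟩ ⟨_, j', rfl⟩ h
    cases h
    rfl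

instance countable_colourLanguage (n k : ℕ) : Countable (colourLanguage n k).Symbols := by
  have : Countable (Σ m, (colourLanguage n k).Functions m) :=
    inferInstanceAs (Countable (Σ _ : ℕ, Empty))
  exact inferInstanceAs (Countable
    ((Σ m, (colourLanguage n k).Functions m) ⊕ (Σ m, (colourLanguage n k).Relations m)))

instance compactSpace_expansionSpace {R : FirstOrder.Language.{u₂, v₂}}
    [Finite (Σ n, R.Relations n)] {M : Type} : CompactSpace (ExpansionSpace R M) where
  isCompact_univ := by
    refine isCompact_expansion isClosed_univ fun F => ?_
    let T : ((Σ i : Σ n, R.Relations n, Fin i.1 → F) → Prop) → ExpansionSpace R M := fun ρ i y =>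
      ∃ h : ∀ j, y j ∈ F, ρ ⟨i, fun j => ⟨y j, h j⟩⟩
    refine ⟨Set.range T, Set.finite_range T, fun S _ => ⟨_, ⟨fun p => S p.1 fun j => p.2 j, rfl⟩, ?_⟩⟩
    intro i y hy
    exact ⟨fun ⟨_, h⟩ => h, fun h => ⟨hy, h⟩⟩

/-- A colouring of embeddings of `A` into `M`, as a family of relations on `M`. -/
def colourPoint {L : FirstOrder.Language.{u, v}} {A M : Type} [L.Structure A] [L.Structure M]
    {n k : ℕ} (a : A ≃ Fin n) (c : (A ↪[L] M) → Fin k) : ExpansionSpace (colourLanguage n k) M :=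
  fun i y => ∃ e : A ↪[L] M, (∀ x, y (Fin.cast i.2.2.symm (a x)) = e x) ∧ c e = i.2.1

variable {L : FirstOrder.Language.{u, v}} {R : FirstOrder.Language.{u₂, v₂}}
  {M : Type} [L.Structure M] [R.Structure M]

/-- In the universal minimal flow, the orbit of a colouring accumulates, jointly with that of the
expansion, at a colouring which is invariant under the automorphisms of the expansion. -/
theorem exists_invariant_accumulation [Countable R.Symbols]
    (h : IsUniversalMinimalFlow.{0, v₂, w} (M ≃[L] M) (orbitClosure L R M))
    {R' : FirstOrder.Language.{0, 0}} [Countable R'.Symbols] [CompactSpace (ExpansionSpace R' M)]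
    (χ : ExpansionSpace R' M) :
    ∃ χ' : ExpansionSpace R' M, (∀ s : M ≃[L.sum R] M, reductEquiv s • χ' = χ') ∧
      ∀ F : Finset M, ∃ g : M ≃[L] M,
        AgreeOn F (expansionPoint R M) (g • expansionPoint R M) ∧ AgreeOn F χ' (g • χ) := by
  have := h.compactSpace
  have := h.nonempty
  have := h.minimal
  let x₀ : orbitClosure L R M := ⟨expansionPoint R M, expansionPoint_mem_orbitClosure⟩
  let p₀ : orbitClosure L R M × ExpansionSpace R' M := (x₀, χ)
  obtain ⟨Z, hZ, hZc, ⟨z₀, hz₀⟩, hZmin⟩ := exists_minimal_subflow (closureOrbit (M ≃[L] M) p₀)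
    isClosed_closure ⟨p₀, subset_closure (MulAction.mem_orbit_self _)⟩
  have : CompactSpace Z := isCompact_iff_compactSpace.1 hZc.isCompact
  have : Nonempty Z := ⟨⟨z₀, hz₀⟩⟩
  have : MulAction.IsMinimal (M ≃[L] M) Z := isMinimal_subflow Z hZc hZmin
  obtain ⟨π, hπ, hπg⟩ := h.universal.exists_factor Z
  -- An endomorphism of X*, so injective by coalescence; a preimage of R* then inherits the
  -- invariance of R* under automorphisms of the expansion, and `π` passes it on to the second
  -- coordinate.
  let φ : orbitClosure L R M → orbitClosure L R M := fun x => (π x).1.1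
  have hφ : Continuous φ := by fun_prop
  have hφg : ∀ (g : M ≃[L] M) x, φ (g • x) = g • φ x := fun g x => by
    change (π (g • x)).1.1 = _
    rw [hπg]
    rfl
  have hinj := injective_of_universal h.universal hφ hφg
  obtain ⟨x, hx⟩ := surjective_of_isMinimal hφ hφg x₀
  refine ⟨(π x).1.2, fun s => ?_, fun F => ?_⟩
  · have h1 : reductEquiv s • x = x := by
      apply hinj
      rw [hφg, hx]
      exact Subtype.ext (reductEquiv_smul_expansionPoint s)
    have h2 := hπg (reductEquiv s) x
    rw [h1] at h2
    exact (congrArg (fun z : Z => z.1.2) h2).symm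
  · have h1 : (π x).1 ∈ closure (MulAction.orbit (M ≃[L] M) p₀) := hZ (π x).2
    have h2 : {p : orbitClosure L R M × ExpansionSpace R' M |
        AgreeOn F (π x).1.1.1 p.1.1 ∧ AgreeOn F (π x).1.2 p.2} ∈ nhds (π x).1 := by
      refine Filter.inter_mem ?_ ?_
      · exact (continuous_subtype_val.comp continuous_fst).continuousAt.preimage_mem_nhds
          (expansion_mem_nhds.2 ⟨F, fun T hT => hT⟩)
      · exact continuous_snd.continuousAt.preimage_mem_nhds
          (expansion_mem_nhds.2 ⟨F, fun T hT => hT⟩)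
    obtain ⟨_, ⟨h3, h4⟩, ⟨g, rfl⟩⟩ := mem_closure_iff_nhds.1 h1 _ h2
    refine ⟨g, ?_, h4⟩
    have h5 : (π x).1.1 = x₀ := hx
    rw [h5] at h3
    exact h3

/-- An embedding into the expansion can be translated by an automorphism of the reduct which
preserves the expansion on the range of the embedding. -/
theorem exists_translated_embedding [R.IsRelational] {D : Type} [(L.sum R).Structure D]
    (d : D ↪[L.sum R] M) (g : M ≃[L] M)
    (hg : ∀ (i : Σ n, R.Relations n) (y : Fin i.1 → M), (∀ j, y j ∈ Set.range d) →
      (expansionPoint R M i y ↔ (g • expansionPoint R M) i y)) :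
    ∃ f : D ↪[L.sum R] M, ∀ x, f x = (g⁻¹ : M ≃[L] M) (d x) := by
  refine ⟨{ toEmbedding := d.toEmbedding.trans (g⁻¹ : M ≃[L] M).toEquiv.toEmbedding
            map_fun' := ?_
            map_rel' := ?_ }, fun _ => rfl⟩
  · rintro n (f | f) y
    · exact (congrArg (g⁻¹ : M ≃[L] M) (d.map_fun' (Sum.inl f : (L.sum R).Functions n) y)).trans
        ((g⁻¹ : M ≃[L] M).map_fun' f (d ∘ y))
    · exact isEmptyElim f
  · rintro n (r | r) y
    · exact ((g⁻¹ : M ≃[L] M).map_rel' r (d ∘ y)).trans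
        (d.map_rel' (Sum.inl r : (L.sum R).Relations n) y)
    · exact (hg ⟨n, r⟩ (d ∘ y) fun j => ⟨y j, rfl⟩).symm.trans
        (d.map_rel' (Sum.inr r : (L.sum R).Relations n) y)

theorem embArrow_of_isUniversalMinimalFlow [R.IsRelational] [Countable R.Symbols]
    (hM : IsFraisseStructure (L.sum R) M)
    (h : IsUniversalMinimalFlow.{0, v₂, w} (M ≃[L] M) (orbitClosure L R M))
    (k : ℕ) (A : Bundled.{0} (L.sum R).Structure) (hA : A ∈ (L.sum R).age M)
    (B : Bundled.{0} (L.sum R).Structure) (hB : B ∈ (L.sum R).age M) :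
    EmbArrow (L.sum R) A B M k := by
  classical
  have := finite_of_mem_age hM hA
  have := finite_of_mem_age hM hB
  intro c
  obtain ⟨n, ⟨a⟩⟩ := Finite.exists_equiv_fin A
  obtain ⟨χ, hinv, hacc⟩ := exists_invariant_accumulation h (colourPoint a c)
  have hemb : ∀ (D : Bundled.{0} (L.sum R).Structure) [Finite D] (d : D ↪[L.sum R] M),
      ∃ (g : M ≃[L] M) (f : D ↪[L.sum R] M), (∀ x, f x = (g⁻¹ : M ≃[L] M) (d x)) ∧
        ∀ i y, (∀ j, y j ∈ Set.range d) → (χ i y ↔ (g • colourPoint a c) i y) := by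
    intro D _ d
    obtain ⟨g, hg, hχ⟩ := hacc (Set.finite_range d).toFinset
    obtain ⟨f, hf⟩ := exists_translated_embedding d g fun i y hy => hg i y fun j => by
      simpa using hy j
    exact ⟨g, f, hf, fun i y hy => hχ i y fun j => by simpa using hy j⟩
  obtain ⟨e₀⟩ := hA.2
  obtain ⟨b⟩ := hB.2
  obtain ⟨g₀, f₀, hf₀, hχ₀⟩ := hemb A e₀
  -- The limit colouring gives `e₀` the colour of `f₀`; by invariance and ultrahomogeneity it gives
  -- every embedding of `A` that colour.
  have hall : ∀ e : A ↪[L.sum R] M, χ (colourSymbol (c f₀)) fun l => e (a.symm l) := by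
    intro e
    obtain ⟨s, hs⟩ := exists_equiv_of_embeddings hM.ultrahomogeneous hA.1 e e₀
    have h1 : χ (colourSymbol (c f₀)) fun l => e₀ (a.symm l) := by
      refine (hχ₀ _ _ fun j => ⟨_, rfl⟩).2 ⟨f₀, fun x => ?_, rfl⟩
      rw [hf₀]
      change (g₀⁻¹ : M ≃[L] M) (e₀ (a.symm (a x))) = _
      rw [Equiv.symm_apply_apply]
    rw [← hinv s]
    change χ (colourSymbol (c f₀)) fun l => ((reductEquiv s)⁻¹ : M ≃[L] M) (e (a.symm l))
    have h2 : ∀ x, ((reductEquiv s)⁻¹ : M ≃[L] M) (e x) = e₀ x := fun x => by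
      rw [← hs x]
      exact aut_inv_apply_self (reductEquiv s) (e₀ x)
    simpa only [h2] using h1
  -- On the range of `b` the limit agrees with a translate of the original colouring, so the
  -- translated copy `f` of `B` is monochromatic for `c`.
  obtain ⟨g, f, hf, hχ⟩ := hemb B b
  have hmono : ∀ e : A ↪[L.sum R] B, c (f.comp e) = c f₀ := by
    intro e
    obtain ⟨e', he', hc⟩ := (hχ _ _ fun j => ⟨_, rfl⟩).1 (hall (b.comp e))
    have h1 : e' = f.comp e := by
      ext x
      rw [← he' x]
      change (g⁻¹ : M ≃[L] M) (b (e (a.symm (a x)))) = f (e x)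
      rw [Equiv.symm_apply_apply, hf]
    rw [← h1, hc]
    rfl
  exact ⟨f, fun e₁ e₂ => (hmono e₁).trans (hmono e₂).symm⟩

end Colourings

end KPT

theorem theorem5 (L : FirstOrder.Language.{u, v}) (R : FirstOrder.Language.{u₂, v₂})
    [Countable L.Symbols] [Countable R.Symbols] [R.IsRelational]
    (M : Type) [L.Structure M] [R.Structure M]
    (hF : KPT.IsFraisseStructure L M)
    (hFstar : KPT.IsFraisseStructure (L.sum R) M)
    (hpre : KPT.IsPrecompactExpansion L R M)
    (hrigid : KPT.ConsistsOfRigid ((L.sum R).age M)) :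
    KPT.IsUniversalMinimalFlow.{0, v₂, w} (M ≃[L] M) (KPT.orbitClosure L R M) ↔
      KPT.RamseyProperty ((L.sum R).age M) ∧ KPT.ExpansionProperty L R M := by
  rw [KPT.ramseyProperty_age_iff hFstar hrigid]
  constructor
  · intro h
    exact ⟨KPT.embArrow_of_isUniversalMinimalFlow hFstar h,
      KPT.expansionProperty_of_isMinimal hF hpre h.minimal⟩
  · rintro ⟨hR, hexp⟩
    have : CompactSpace (KPT.orbitClosure L R M) :=
      isCompact_iff_compactSpace.1 (KPT.isCompact_orbitClosure hF hpre)
    have hmin := KPT.isMinimal_of_expansionProperty hF hexp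
    exact
      { continuousSMul := inferInstance
        compactSpace := this
        t2Space := inferInstance
        nonempty := ⟨⟨_, KPT.expansionPoint_mem_orbitClosure⟩⟩
        minimal := hmin
        universal := KPT.isUniversalFlow_of_ramsey hF hFstar hR }
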